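/- For non-negative integers $n,r,s$ let $a_n(r,s)=\sum_{k=0}^n\binom nk^r\binom{n+k}k^s$ be the (generalised) Apéry numbers, and let $\chi(\mathcal S)=1$ if the assertion $\mathcal S$ is true and $\chi(\mathcal S)=0$ otherwise. For all positive integers $r$ and all non-negative integers $n=n_0+3n_1+9n_2+\dots+3^mn_m$, where $0\le n_i\le 2$ for all $i$, we have $$a_n(r,0)\equiv\prod_{i=0}^m a_{n_i}(r,0)+3\sum_{\nu=1}^m\Bigg(\prod_{\substack{0\le i\le m\\ i\ne\nu-1,\nu}}a_{n_i}(r,0)\Bigg)f(n_{\nu-1},n_\nu;r,0)\pmod 9,$$ where $$f(n_{\nu-1},n_\nu;r,0)=\chi(r=1)\big(n_\nu-\chi(n_\nu=2)\big)\big(\chi(n_{\nu-1}=2)-1\big)-r\,\big(n_\nu+(-1)^r\chi(n_\nu=2)\big)\big(\chi(n_{\nu-1}=1)-(-1)^r\chi(n_{\nu-1}=2)\big).$$ -/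

import Mathlib

/-- The (generalised) Apéry numbers `a_n(r,s) = ∑_{k=0}^n (n choose k)^r (n+k choose k)^s`.
For `s = 0` these are the generalised Franel numbers. -/
def aperyNumber (n r s : ℕ) : ℕ :=
  ∑ k ∈ Finset.range (n + 1), n.choose k ^ r * (n + k).choose k ^ s

/-- The truth value `χ(P)`: it is `1` if `P` is true and `0` otherwise. -/
def chi (P : Prop) [Decidable P] : ℤ := if P then 1 else 0

/-- The correction term `f(u, v; r, 0)`, where `u` is a ternary digit and `v` is the next more
significant one. -/
def franelCorrection (u v r : ℕ) : ℤ :=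
  chi (r = 1) * ((v : ℤ) - chi (v = 2)) * (chi (u = 2) - 1)
    - (r : ℤ) * ((v : ℤ) + chi (v = 2) * (-1) ^ r) * (chi (u = 1) - (-1) ^ r * chi (u = 2))

open Finset

section Choose

theorem three_dvd_choose_add_one (n j : ℕ) : 3 ∣ (3 * n).choose (3 * j + 1) := by
  have h := Nat.choose_succ_right_eq (3 * n) (3 * j)
  refine (Nat.Coprime.dvd_of_dvd_mul_right (n := 3 * j + 1) ?_ ?_)
  · simp
  · rw [h, ← Nat.mul_sub]
    exact Dvd.dvd.mul_left (dvd_mul_right _ _) _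

theorem three_dvd_choose_add_two (n j : ℕ) : 3 ∣ (3 * n).choose (3 * j + 2) := by
  have h := Nat.choose_succ_right_eq (3 * n) (3 * j + 1)
  refine (Nat.Coprime.dvd_of_dvd_mul_right (n := 3 * j + 2) ?_ ?_)
  · simpa using (by decide : Odd 3)
  · rw [h]
    exact (three_dvd_choose_add_one n j).mul_right _

theorem three_dvd_choose_succ_add_two (n j : ℕ) : 3 ∣ (3 * n + 1).choose (3 * j + 2) := by
  rw [Nat.choose_succ_succ]
  exact dvd_add (three_dvd_choose_add_one n j) (three_dvd_choose_add_two n j)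

theorem ZMod.nine_eq_zero : (9 : ZMod 9) = 0 := by decide

theorem ZMod.three_mul_natCast_eq_zero {x : ℕ} (h : 3 ∣ x) : 3 * (x : ZMod 9) = 0 := by
  obtain ⟨y, rfl⟩ := h
  push_cast
  linear_combination (y : ZMod 9) * ZMod.nine_eq_zero

theorem ZMod.natCast_pow_eq_zero {x r : ℕ} (h : 3 ∣ x) (hr : 2 ≤ r) : (x : ZMod 9) ^ r = 0 := by
  obtain ⟨y, rfl⟩ := h
  obtain ⟨s, rfl⟩ := Nat.exists_eq_add_of_le hr
  push_cast
  rw [pow_add]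
  linear_combination (y : ZMod 9) ^ 2 * (3 * (y : ZMod 9)) ^ s * ZMod.nine_eq_zero

/-- Ljunggren's congruence at the prime `3`, modulo `9`. -/
theorem choose_three_mul (n j : ℕ) :
    ((3 * n).choose (3 * j) : ZMod 9) = n.choose j := by
  induction n generalizing j with
  | zero => cases j <;> simp [Nat.mul_add]
  | succ n ih =>
    cases j with
    | zero => simp
    | succ j =>
      have e : (3 * (n + 1)).choose (3 * (j + 1)) = (3 * n).choose (3 * j)
          + 3 * (3 * n).choose (3 * j + 1) + 3 * (3 * n).choose (3 * j + 2)
          + (3 * n).choose (3 * (j + 1)) := by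
        simp only [Nat.mul_add, mul_one, Nat.choose_succ_succ]
        ring
      rw [e, Nat.choose_succ_succ]
      push_cast
      rw [ih, ih, ZMod.three_mul_natCast_eq_zero (three_dvd_choose_add_one n j),
        ZMod.three_mul_natCast_eq_zero (three_dvd_choose_add_two n j)]
      simp

theorem choose_three_mul_add_one {n j : ℕ} (h : j ≤ n) :
    ((3 * n + 1).choose (3 * j) : ZMod 9) = n.choose j * (1 + 3 * j) := by
  obtain ⟨t, rfl⟩ := Nat.exists_eq_add_of_le h
  have e := Nat.choose_mul_succ_eq (3 * (j + t)) (3 * j)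
  rw [show 3 * (j + t) + 1 - 3 * j = 3 * t + 1 by omega] at e
  have e' := congrArg (Nat.cast : ℕ → ZMod 9) e
  push_cast at e' ⊢
  rw [choose_three_mul] at e'
  set X := ((3 * (j + t) + 1).choose (3 * j) : ZMod 9)
  linear_combination (-(1 - 3 * (t : ZMod 9))) * e'
    + (X * t ^ 2 - ((j + t).choose j : ZMod 9) * t * (j + t)) * ZMod.nine_eq_zero

theorem choose_three_mul_add_one_add_one {n j : ℕ} (h : j ≤ n) :
    ((3 * n + 1).choose (3 * j + 1) : ZMod 9) = n.choose j * (1 + 3 * (n - j)) := by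
  rw [← Nat.choose_symm_of_eq_add (show 3 * n + 1 = 3 * (n - j) + (3 * j + 1) by omega),
    choose_three_mul_add_one (Nat.sub_le n j), Nat.choose_symm h, Nat.cast_sub h]

theorem choose_three_mul_add_two {n j : ℕ} (h : j ≤ n) :
    ((3 * n + 2).choose (3 * j) : ZMod 9) = n.choose j := by
  have e := Nat.choose_mul_succ_eq (3 * n + 1) (3 * j)
  obtain ⟨t, rfl⟩ := Nat.exists_eq_add_of_le h
  rw [show 3 * (j + t) + 1 + 1 - 3 * j = 3 * t + 2 by omega] at e
  have e' := congrArg (Nat.cast : ℕ → ZMod 9) e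
  push_cast at e' ⊢
  rw [choose_three_mul_add_one h] at e'
  rw [show 3 * (j + t) + 1 + 1 = 3 * (j + t) + 2 from rfl] at e'
  set X := ((3 * (j + t) + 2).choose (3 * j) : ZMod 9)
  set C := ((j + t).choose j : ZMod 9)
  linear_combination (-(5 + 6 * (t : ZMod 9))) * e'
    + (-X * (1 + 3 * t + 2 * t ^ 2) + C * (1 + 3 * t + 2 * t ^ 2) + C * (5 * j + 11 * j * t
      + 6 * j * t ^ 2 + 5 * j ^ 2 + 6 * j ^ 2 * t)) * ZMod.nine_eq_zero

theorem choose_three_mul_add_two_add_two {n j : ℕ} (h : j ≤ n) :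
    ((3 * n + 2).choose (3 * j + 2) : ZMod 9) = n.choose j := by
  rw [← Nat.choose_symm_of_eq_add (show 3 * n + 2 = 3 * (n - j) + (3 * j + 2) by omega),
    choose_three_mul_add_two (Nat.sub_le n j), Nat.choose_symm h]

theorem choose_three_mul_add_two_add_one {n j : ℕ} (h : j ≤ n) :
    ((3 * n + 2).choose (3 * j + 1) : ZMod 9) = n.choose j * (2 + 3 * n) := by
  rw [Nat.choose_succ_succ]
  push_cast
  rw [choose_three_mul_add_one h, choose_three_mul_add_one_add_one h]
  ring

end Choose

section Franel

theorem aperyNumber_zero_right (n r : ℕ) :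
    aperyNumber n r 0 = ∑ k ∈ range (n + 1), n.choose k ^ r := by
  simp [aperyNumber]

theorem aperyNumber_eq_sum_range {n r N : ℕ} (hr : r ≠ 0) (h : n < N) :
    aperyNumber n r 0 = ∑ k ∈ range N, n.choose k ^ r := by
  rw [aperyNumber_zero_right]
  refine sum_subset (range_mono h) fun k _ hk => ?_
  rw [Nat.choose_eq_zero_of_lt (by simpa [Nat.lt_succ_iff] using hk), zero_pow hr]

theorem sum_range_three_mul {M : Type*} [AddCommMonoid M] (f : ℕ → M) (n : ℕ) :
    ∑ k ∈ range (3 * n), f k = ∑ j ∈ range n, (f (3 * j) + f (3 * j + 1) + f (3 * j + 2)) := by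
  induction n with
  | zero => simp
  | succ n ih =>
    rw [sum_range_succ, ← ih, Nat.mul_add, mul_one, sum_range_succ, sum_range_succ,
      sum_range_succ]
    simp only [add_assoc]

theorem aperyNumber_three_mul_add {r u : ℕ} (hr : r ≠ 0) (hu : u ≤ 2) (n : ℕ) :
    (aperyNumber (3 * n + u) r 0 : ZMod 9) = ∑ j ∈ range (n + 1),
      (((3 * n + u).choose (3 * j) : ZMod 9) ^ r + ((3 * n + u).choose (3 * j + 1) : ZMod 9) ^ r
        + ((3 * n + u).choose (3 * j + 2) : ZMod 9) ^ r) := by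
  rw [aperyNumber_eq_sum_range hr (show 3 * n + u < 3 * (n + 1) by omega), sum_range_three_mul]
  push_cast
  rfl

theorem natCast_aperyNumber (n r : ℕ) :
    (aperyNumber n r 0 : ZMod 9) = ∑ j ∈ range (n + 1), (n.choose j : ZMod 9) ^ r := by
  rw [aperyNumber_zero_right]
  push_cast
  rfl

theorem ZMod.add_three_mul_pow (c x : ZMod 9) (r : ℕ) :
    (c + 3 * x) ^ (r + 1) = c ^ (r + 1) + 3 * (r + 1) * c ^ r * x := by
  induction r with
  | zero => simp
  | succ r ih =>
    rw [pow_succ, ih]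
    push_cast
    linear_combination ((r : ZMod 9) + 1) * c ^ r * x ^ 2 * ZMod.nine_eq_zero

theorem ZMod.one_add_three_mul_pow (x : ZMod 9) (r : ℕ) : (1 + 3 * x) ^ r = 1 + 3 * r * x := by
  cases r with
  | zero => simp
  | succ r => simpa using ZMod.add_three_mul_pow 1 x r

theorem ZMod.three_mul_two_pow (r : ℕ) : (3 : ZMod 9) * 2 ^ r = 3 * (-1) ^ r := by
  induction r with
  | zero => simp
  | succ r ih =>
    rw [pow_succ, pow_succ]
    linear_combination 2 * ih + (-1) ^ r * ZMod.nine_eq_zero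

theorem ZMod.two_add_three_mul_pow (x : ZMod 9) {r : ℕ} (hr : r ≠ 0) :
    (2 + 3 * x) ^ r = 2 ^ r - 3 * r * (-1) ^ r * x := by
  obtain ⟨r, rfl⟩ := Nat.exists_eq_succ_of_ne_zero hr
  rw [Nat.succ_eq_add_one, ZMod.add_three_mul_pow, pow_succ (-1 : ZMod 9)]
  push_cast
  linear_combination ((r : ZMod 9) + 1) * x * ZMod.three_mul_two_pow r

/-- The coefficient of `3 * n` in the congruence for `aperyNumber (3 * n + u) r 0`. -/
def franelSlope (r u : ℕ) : ℤ :=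
  if r = 1 then 2 ^ u else r * (chi (u = 1) - (-1) ^ r * chi (u = 2))

theorem aperyNumber_one_zero (n : ℕ) : aperyNumber n 1 0 = 2 ^ n := by
  simp [aperyNumber_zero_right, Nat.sum_range_choose]

theorem aperyNumber_zero_eq (r : ℕ) : aperyNumber 0 r 0 = 1 := by
  simp [aperyNumber_zero_right]

theorem aperyNumber_one_eq (r : ℕ) : aperyNumber 1 r 0 = 2 := by
  simp [aperyNumber_zero_right, sum_range_succ]

theorem aperyNumber_two_eq (r : ℕ) : aperyNumber 2 r 0 = 2 + 2 ^ r := by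
  simp [aperyNumber_zero_right, sum_range_succ]
  ring

/-- The one-digit recurrence for generalised Franel numbers modulo `9`. -/
theorem aperyNumber_digit_recurrence {r u : ℕ} (hr : 1 ≤ r) (hu : u ≤ 2) (n : ℕ) :
    (aperyNumber (3 * n + u) r 0 : ZMod 9) =
      aperyNumber n r 0 * (aperyNumber u r 0 + 3 * n * (franelSlope r u : ZMod 9)) := by
  obtain rfl | hr2 := hr.eq_or_lt
  · simp only [aperyNumber_one_zero, franelSlope, if_true]
    push_cast
    rw [pow_add, pow_mul, show (2 : ZMod 9) ^ 3 = 2 * (1 + 3 * 1) by decide, mul_pow,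
      ZMod.one_add_three_mul_pow]
    ring
  rw [aperyNumber_three_mul_add (by omega) hu, natCast_aperyNumber n, sum_mul]
  refine sum_congr rfl fun j hj => ?_
  have hj : j ≤ n := by simpa [Nat.lt_succ_iff] using hj
  interval_cases u
  · rw [add_zero, choose_three_mul, ZMod.natCast_pow_eq_zero (three_dvd_choose_add_one n j) hr2,
      ZMod.natCast_pow_eq_zero (three_dvd_choose_add_two n j) hr2, aperyNumber_zero_eq]
    simp [franelSlope, chi, hr2.ne']
  · rw [choose_three_mul_add_one hj, choose_three_mul_add_one_add_one hj,
      ZMod.natCast_pow_eq_zero (three_dvd_choose_succ_add_two n j) hr2, aperyNumber_one_eq,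
      mul_pow, mul_pow, ZMod.one_add_three_mul_pow, ZMod.one_add_three_mul_pow]
    simp [franelSlope, chi, hr2.ne']
    ring
  · rw [choose_three_mul_add_two hj, choose_three_mul_add_two_add_one hj,
      choose_three_mul_add_two_add_two hj, aperyNumber_two_eq, mul_pow,
      ZMod.two_add_three_mul_pow _ (by omega)]
    simp [franelSlope, chi, hr2.ne']
    ring

theorem three_mul_franelCorrection {r u v : ℕ} (hu : u ≤ 2) (hv : v ≤ 2) :
    3 * (franelCorrection u v r : ZMod 9) =
      3 * v * aperyNumber v r 0 * (franelSlope r u : ZMod 9) := by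
  obtain rfl | hr := eq_or_ne r 1
  · interval_cases u <;> interval_cases v <;> decide
  have h := ZMod.three_mul_two_pow r
  simp only [franelCorrection, franelSlope, if_neg hr]
  set y : ℤ := chi (u = 1) - (-1) ^ r * chi (u = 2)
  interval_cases v
  · simp [chi]
  · rw [aperyNumber_one_eq]
    simp [chi, hr]
    linear_combination (-(r : ZMod 9) * y) * ZMod.nine_eq_zero
  · rw [aperyNumber_two_eq]
    simp [chi, hr]
    linear_combination (-2 * (r : ZMod 9) * y) * h
      - ((r : ZMod 9) * y * (2 + (-1) ^ r)) * ZMod.nine_eq_zero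

end Franel

section Digits

variable {R : Type*} [CommRing R] {A g : ℕ → R} {F : ℕ → ℕ → R}

theorem sum_digits_succ (d : ℕ → ℕ) (m : ℕ) :
    ∑ i ∈ range (m + 1), d i * 3 ^ i = 3 * ∑ i ∈ range m, d (i + 1) * 3 ^ i + d 0 := by
  rw [sum_range_succ', mul_sum]
  simp only [pow_succ, pow_zero, mul_one, add_left_inj]
  exact sum_congr rfl fun i _ => by ring

theorem three_mul_digits_prod (h9 : (9 : R) = 0)
    (hA : ∀ n, ∀ u ≤ 2, A (3 * n + u) = A n * (A u + 3 * n * g u)) (m : ℕ) (d : ℕ → ℕ)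
    (hd : ∀ i ≤ m, d i ≤ 2) :
    3 * A (∑ i ∈ range (m + 1), d i * 3 ^ i) = 3 * ∏ i ∈ range (m + 1), A (d i) := by
  induction m generalizing d with
  | zero => simp
  | succ m ih =>
    have h := ih (fun i => d (i + 1)) fun i hi => hd (i + 1) (by omega)
    rw [sum_digits_succ, prod_range_succ', hA _ _ (hd 0 (by omega))]
    set N := ∑ i ∈ range (m + 1), d (i + 1) * 3 ^ i
    linear_combination A (d 0) * h + A N * N * g (d 0) * h9

/-- A sequence satisfying a one-digit recurrence modulo `9` in base `3` is given by the product
over the digits, corrected by a sum over pairs of consecutive digits. -/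
theorem digits_expansion (h9 : (9 : R) = 0)
    (hA : ∀ n, ∀ u ≤ 2, A (3 * n + u) = A n * (A u + 3 * n * g u))
    (hF : ∀ u ≤ 2, ∀ v ≤ 2, 3 * F u v = 3 * v * A v * g u) (m : ℕ) (d : ℕ → ℕ)
    (hd : ∀ i ≤ m, d i ≤ 2) :
    A (∑ i ∈ range (m + 1), d i * 3 ^ i) = ∏ i ∈ range (m + 1), A (d i)
      + 3 * ∑ ν ∈ range m, (∏ i ∈ range (m + 1) with i ≠ ν ∧ i ≠ ν + 1, A (d i))
          * F (d ν) (d (ν + 1)) := by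
  induction m generalizing d with
  | zero => simp
  | succ m ih =>
    have h := ih (fun i => d (i + 1)) fun i hi => hd (i + 1) (by omega)
    have hprod := three_mul_digits_prod h9 hA m (fun i => d (i + 1))
      fun i hi => hd (i + 1) (by omega)
    have hmod : 3 * ((∑ i ∈ range (m + 1), d (i + 1) * 3 ^ i : ℕ) : R) = 3 * (d 1 : R) := by
      rw [sum_digits_succ (fun i => d (i + 1))]
      push_cast
      linear_combination (∑ i ∈ range m, (d (i + 1 + 1) : R) * 3 ^ i) * h9
    have hfirst : ∏ i ∈ range (m + 1 + 1) with i ≠ 0 ∧ i ≠ 0 + 1, A (d i)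
        = ∏ i ∈ range m, A (d (i + 1 + 1)) := by
      rw [prod_filter, prod_range_succ', prod_range_succ']
      simp
    have hrest (ν : ℕ) : ∏ i ∈ range (m + 1 + 1) with i ≠ ν + 1 ∧ i ≠ ν + 1 + 1, A (d i)
        = (∏ i ∈ range (m + 1) with i ≠ ν ∧ i ≠ ν + 1, A (d (i + 1))) * A (d 0) := by
      rw [prod_filter, prod_filter, prod_range_succ']
      simp
    rw [sum_digits_succ]
    set N := ∑ i ∈ range (m + 1), d (i + 1) * 3 ^ i
    rw [prod_range_succ', sum_range_succ', hfirst, hA _ _ (hd 0 (by omega))]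
    simp only [hrest, mul_right_comm _ (A (d 0)), ← sum_mul]
    rw [prod_range_succ' (fun i => A (d (i + 1)))] at hprod h ⊢
    have hF' := hF (d 0) (hd 0 (by omega)) (d (0 + 1)) (hd 1 (by omega))
    simp only [zero_add] at hF' h hprod ⊢
    linear_combination A (d 0) * h + A N * g (d 0) * hmod + (d 1 : R) * g (d 0) * hprod
      - (∏ i ∈ range m, A (d (i + 1 + 1))) * hF'

end Digits

theorem theorem2 (r : ℕ) (hr : 1 ≤ r) (m n : ℕ) (d : ℕ → ℕ)
    (hd : ∀ i ≤ m, d i ≤ 2)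
    (hn : n = ∑ i ∈ Finset.range (m + 1), d i * 3 ^ i) :
    (aperyNumber n r 0 : ℤ) ≡
      ∏ i ∈ Finset.range (m + 1), (aperyNumber (d i) r 0 : ℤ)
        + 3 * ∑ ν ∈ Finset.Icc 1 m,
            (∏ i ∈ (Finset.range (m + 1)).filter (fun i => i ≠ ν - 1 ∧ i ≠ ν),
              (aperyNumber (d i) r 0 : ℤ))
            * franelCorrection (d (ν - 1)) (d ν) r [ZMOD 9] := by
  refine (ZMod.intCast_eq_intCast_iff _ _ 9).1 ?_
  have h := digits_expansion (R := ZMod 9) (A := fun n => (aperyNumber n r 0 : ZMod 9))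
    (g := fun u => (franelSlope r u : ZMod 9)) (F := fun u v => (franelCorrection u v r : ZMod 9))
    ZMod.nine_eq_zero (fun n u hu => aperyNumber_digit_recurrence hr hu n)
    (fun u hu v hv => three_mul_franelCorrection hu hv) m d hd
  rw [← hn] at h
  rw [← Finset.Ico_add_one_right_eq_Icc, Finset.sum_Ico_eq_sum_range]
  simp only [Nat.add_sub_cancel, add_comm 1]
  push_cast
  exact h
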